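/- Let $E$ be a separable real Banach space with dual $E^*$, let $(\Omega,\mathcal F,P)$ be a complete probability space, and let $\mathcal H\subseteq\mathcal F$ be a sub-$\sigma$-algebra. For a $\sigma$-algebra $\mathcal G\subseteq\mathcal F$, a map $X$ from $\Omega$ to the subsets of $E$ (possibly empty, not necessarily closed) is called a $\mathcal G$-measurable random set if its graph $\{(\omega,x): x\in X(\omega)\}$ belongs to $\mathcal G\otimes\mathcal B(E)$; a random set is an $\mathcal F$-measurable random set, and it is called closed (convex) if $X(\omega)$ is closed (convex) for almost all $\omega$. The support function of $A\subseteq E$ is $h_A(u)=\sup\{\langle u,x\rangle: x\in A\}\in[-\infty,\infty]$ for $u\in E^*$, with $h_\emptyset=-\infty$. Let $X$ be a random set. Then the conditional convex hull $\mathbf M(X|\mathcal H)$ exists, that is, there is an $\mathcal H$-measurable random closed convex set $M$ such that $X\subseteq M$ a.s. and such that $M\subseteq Y$ a.s. for every $\mathcal H$-measurable random closed convex set $Y$ with $X\subseteq Y$ a.s. Moreover, for every such $M$ and every $\zeta:\Omega\to E^*$ such that $\langle\zeta,x\rangle$ is $\mathcal H$-measurable for all $x\in E$, the function $h_X(\zeta)$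 is an $\mathcal F$-measurable random variable with values in $[-\infty,\infty]$, and $$h_{M}(\zeta)=\operatorname{ess\,sup}_{\mathcal H} h_X(\zeta)\quad\text{a.s.},$$ where $\operatorname{ess\,sup}_{\mathcal H} h_X(\zeta)$ is the $\mathcal H$-conditional essential supremum: the a.s. smallest $\mathcal H$-measurable random variable with values in $[-\infty,\infty]$ that is a.s. greater than or equal to $h_X(\zeta)$ (in particular, it exists). -/

import Mathlib

open MeasureTheory

/-- The graph `{(ω, x) : x ∈ X(ω)}` of a set-valued map. -/
def setGraph {Ω E : Type*} (X : Ω → Set E) : Set (Ω × E) :=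
  {p | p.2 ∈ X p.1}

/-- An `m`-measurable random set: a set-valued map (its values may be empty and need not be closed)
whose graph belongs to the product of `m` and the `σ`-algebra of `E`. -/
def IsRandomSet {Ω E : Type*} [MeasurableSpace E] (m : MeasurableSpace Ω) (X : Ω → Set E) : Prop :=
  MeasurableSet[m.prod inferInstance] (setGraph X)

/-- An `H`-measurable random closed convex set: an `H`-measurable random set whose values are closed
and convex almost surely. -/
structure IsRandomClosedConvexSet {Ω E : Type*} [NormedAddCommGroup E] [NormedSpace ℝ E]
    [MeasurableSpace E] (H : MeasurableSpace Ω) {mΩ : MeasurableSpace Ω} (P : Measure[mΩ] Ω)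
    (X : Ω → Set E) : Prop where
  isRandomSet : IsRandomSet H X
  isClosed : ∀ᵐ ω ∂P, IsClosed (X ω)
  convex : ∀ᵐ ω ∂P, Convex ℝ (X ω)

/-- `M` is (a version of) the `H`-conditional convex hull of `X`: the smallest, up to null sets,
`H`-measurable random closed convex set that contains `X` almost surely. -/
structure IsCondConvexHull {Ω E : Type*} [NormedAddCommGroup E] [NormedSpace ℝ E]
    [MeasurableSpace E] (H : MeasurableSpace Ω) {mΩ : MeasurableSpace Ω} (P : Measure[mΩ] Ω)
    (X M : Ω → Set E) : Prop where
  isRandomClosedConvexSet : IsRandomClosedConvexSet H P M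
  subset : ∀ᵐ ω ∂P, X ω ⊆ M ω
  minimal : ∀ Y : Ω → Set E, IsRandomClosedConvexSet H P Y →
    (∀ᵐ ω ∂P, X ω ⊆ Y ω) → ∀ᵐ ω ∂P, M ω ⊆ Y ω

/-- The support function `h_A(u) = sup {⟨u, x⟩ : x ∈ A}` with values in `[-∞, ∞]`; it equals `-∞`
for the empty set. -/
noncomputable def supportFun {E : Type*} [NormedAddCommGroup E] [NormedSpace ℝ E]
    (A : Set E) (u : StrongDual ℝ E) : EReal :=
  ⨆ x ∈ A, ((u x : ℝ) : EReal)

/-- An `m`-measurable random element of the dual space: `⟨ζ, x⟩` is an `m`-measurable random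
variable for every `x`. -/
def IsRandomFunctional {Ω E : Type*} [NormedAddCommGroup E] [NormedSpace ℝ E]
    (m : MeasurableSpace Ω) (ζ : Ω → StrongDual ℝ E) : Prop :=
  ∀ x : E, Measurable[m] (fun ω => ζ ω x)

/-- `η` is (a version of) the `H`-conditional essential supremum of a family `Ξ` of extended real
random variables: the least, up to null sets, `H`-measurable extended real random variable that
dominates every member of `Ξ` almost surely. -/
structure IsCondEssSup {Ω : Type*} (H : MeasurableSpace Ω) {mΩ : MeasurableSpace Ω}
    (P : Measure[mΩ] Ω) (Ξ : Set (Ω → EReal)) (η : Ω → EReal) : Prop where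
  measurable : Measurable[H] η
  le : ∀ ξ ∈ Ξ, ∀ᵐ ω ∂P, ξ ω ≤ η ω
  minimal : ∀ η' : Ω → EReal, Measurable[H] η' → (∀ ξ ∈ Ξ, ∀ᵐ ω ∂P, ξ ω ≤ η' ω) →
    ∀ᵐ ω ∂P, η ω ≤ η' ω

/-! Existence is by exhaustion. The `H`-measurable closed convex sets containing `X` a.s. are stable
under countable intersections. For each `U` in a countable basis, intersect a sequence minimizing
the probability of hitting `U`; let `M` be the intersection over all `U`. Cutting `M` by a
competitor changes no hitting event beyond a null set, so `M` lies in it a.s. For the formula, `X ⊆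
M` gives one inequality; for the other, if `η'` dominates `h_X(ζ)`, the half-space `⟨ζ, x⟩ ≤ η'` is
a competitor. Hitting events and the events `h_X(ζ) > c` are projections, hence measurable up to
null sets by `MeasurableSet.nullMeasurableSet_image_fst`. -/

open Set Filter Topology MeasureTheory

/-! ### Analytic sets and measurable projection -/

namespace MeasureTheory

/-- The intersection of the closures of the images of the sets `{x | ∀ i < n, x i ≤ a i}` is contained in
the range of `g`. -/
theorem iInter_closure_image_subset_range {Z : Type*} [TopologicalSpace Z]
    [TopologicalSpace.MetrizableSpace Z] {g : (ℕ → ℕ) → Z} (hg : Continuous g) (a : ℕ → ℕ) :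
    ⋂ n, closure (g '' {x | ∀ i < n, x i ≤ a i}) ⊆ range g := by
  let := TopologicalSpace.metrizableSpaceMetric Z
  intro y hy
  have h1 : ∀ n : ℕ, ∃ x : ℕ → ℕ, (∀ i < n, x i ≤ a i) ∧ dist y (g x) < 1 / ((n : ℝ) + 1) := by
    intro n
    obtain ⟨z, ⟨x, hx, rfl⟩, hz⟩ := Metric.mem_closure_iff.1 (mem_iInter.1 hy n)
      (1 / ((n : ℝ) + 1)) (by positivity)
    exact ⟨x, hx, hz⟩
  choose x hx hd using h1
  -- Coordinate `i` of `x n` may exceed `a i` only when `n ≤ i`; the finite sum absorbs these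
  -- exceptions.
  have hK : IsCompact (univ.pi fun i => Iic (a i + ∑ n ∈ Finset.range (i + 1), x n i)) :=
    isCompact_univ_pi fun i => (finite_Iic _).isCompact
  have hxK : ∀ n, x n ∈ univ.pi fun i => Iic (a i + ∑ n ∈ Finset.range (i + 1), x n i) := by
    intro n i _
    rcases lt_or_ge i n with h | h
    · exact (hx n i h).trans (Nat.le_add_right _ _)
    · exact (Finset.single_le_sum (f := fun n => x n i) (fun _ _ => Nat.zero_le _)
        (Finset.mem_range.2 (Nat.lt_succ_of_le h))).trans (Nat.le_add_left _ _)
  obtain ⟨z, -, φ, hφ, hlim⟩ := hK.tendsto_subseq hxK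
  refine ⟨z, ?_⟩
  have h2 : Tendsto (fun n => g (x n)) atTop (𝓝 y) := by
    rw [tendsto_iff_dist_tendsto_zero]
    refine squeeze_zero (fun _ => dist_nonneg) (fun n => ?_) tendsto_one_div_add_atTop_nhds_zero_nat
    rw [dist_comm]
    exact (hd n).le
  exact tendsto_nhds_unique ((hg.tendsto z).comp hlim) (h2.comp hφ.tendsto_atTop)

/-- Inner approximation of the continuous image of the Baire space by measurable sets. -/
theorem exists_measurableSet_subset_range_le_measure {Z : Type*} [TopologicalSpace Z]
    [TopologicalSpace.MetrizableSpace Z] [MeasurableSpace Z] [BorelSpace Z] (μ : Measure Z)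
    [IsFiniteMeasure μ] {g : (ℕ → ℕ) → Z} (hg : Continuous g) {t : ENNReal}
    (ht : t < μ (range g)) : ∃ B ⊆ range g, MeasurableSet B ∧ t ≤ μ B := by
  -- Continuity from below holds for the outer measure, so the images need not be measurable.
  have step : ∀ (n : ℕ) (s : Set (ℕ → ℕ)), t < μ (g '' s) →
      ∃ k, t < μ (g '' (s ∩ {x | x n ≤ k})) := by
    intro n s hs
    have hU : g '' s = ⋃ k, g '' (s ∩ {x | x n ≤ k}) := by
      rw [← image_iUnion, ← inter_iUnion]
      congr 1
      refine (inter_eq_left.2 fun x _ => mem_iUnion.2 ⟨x n, le_refl (x n)⟩).symm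
    have hmono : Monotone fun k => g '' (s ∩ {x | x n ≤ k}) := fun k l hkl =>
      image_mono (inter_subset_inter_right _ fun x (hx : x n ≤ k) => hx.trans hkl)
    rw [hU, hmono.measure_iUnion] at hs
    exact lt_iSup_iff.1 hs
  let T := {s : Set (ℕ → ℕ) // t < μ (g '' s)}
  choose k hk using step
  let S : ℕ → T := fun n => Nat.rec (motive := fun _ => T) ⟨univ, by rwa [image_univ]⟩
    (fun n s => ⟨s.1 ∩ {x | x n ≤ k n s.1 s.2}, hk n s.1 s.2⟩) n
  let a : ℕ → ℕ := fun n => k n (S n).1 (S n).2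
  have hS : ∀ n, (S n).1 = {x | ∀ i < n, x i ≤ a i} := by
    intro n
    induction n with
    | zero => ext x; simp [S]
    | succ n ih =>
      have : (S (n + 1)).1 = (S n).1 ∩ {x | x n ≤ a n} := rfl
      rw [this, ih]
      ext x
      simp only [mem_inter_iff, mem_ofPred_eq, Nat.lt_succ_iff_lt_or_eq]
      constructor
      · rintro ⟨h1, h2⟩ i (hi | rfl)
        exacts [h1 i hi, h2]
      · exact fun h => ⟨fun i hi => h i (Or.inl hi), h n (Or.inr rfl)⟩
  refine ⟨_, iInter_closure_image_subset_range hg a,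
    MeasurableSet.iInter fun n => isClosed_closure.measurableSet, ?_⟩
  have hanti : Antitone fun n => closure (g '' {x : ℕ → ℕ | ∀ i < n, x i ≤ a i}) :=
    fun n m hnm => closure_mono (image_mono fun x hx i hi => hx i (hi.trans_le hnm))
  refine ge_of_tendsto' (tendsto_measure_iInter_atTop
    (fun n => isClosed_closure.measurableSet.nullMeasurableSet) hanti ⟨0, measure_ne_top _ _⟩) ?_
  intro n
  have := (S n).2
  rw [hS n] at this
  exact this.le.trans (measure_mono subset_closure)

/-- Analytic sets are universally measurable. -/
theorem AnalyticSet.nullMeasurableSet {Z : Type*} [TopologicalSpace Z]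
    [TopologicalSpace.MetrizableSpace Z] [MeasurableSpace Z] [BorelSpace Z] {A : Set Z}
    (hA : AnalyticSet A) (μ : Measure Z) [IsFiniteMeasure μ] : NullMeasurableSet A μ := by
  rw [AnalyticSet] at hA
  rcases hA with rfl | ⟨g, hg, rfl⟩
  · exact nullMeasurableSet_empty
  rcases eq_or_ne (μ (range g)) 0 with h0 | h0
  · exact NullMeasurableSet.of_null h0
  obtain ⟨u, -, hu, hlim⟩ := exists_seq_strictMono_tendsto' (pos_iff_ne_zero.2 h0)
  choose B hBs hBm hB using fun n => exists_measurableSet_subset_range_le_measure μ hg (hu n).2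
  have hsub : ⋃ n, B n ⊆ range g := iUnion_subset hBs
  have hle : μ (range g) ≤ μ (⋃ n, B n) :=
    le_of_tendsto' hlim fun n => (hB n).trans (measure_mono (subset_iUnion B n))
  have hm : MeasurableSet (⋃ n, B n) := MeasurableSet.iUnion hBm
  exact hm.nullMeasurableSet.congr (ae_eq_of_subset_of_measure_ge hsub hle hm.nullMeasurableSet
    (measure_ne_top _ _))

/-- A measurable set of a product is the pullback of a measurable set under a map that factors the
first coordinate through the Cantor space. -/
theorem _root_.MeasurableSet.exists_preimage_prodMap_nat_bool {Ω E : Type*} [MeasurableSpace Ω]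
    [MeasurableSpace E] {s : Set (Ω × E)} (hs : MeasurableSet s) :
    ∃ f : Ω → ℕ → Bool, Measurable f ∧ ∃ t : Set ((ℕ → Bool) × E), MeasurableSet t ∧
      s = Prod.map f id ⁻¹' t := by
  classical
  rw [← generateFrom_prod] at hs
  induction s, hs using MeasurableSpace.generateFrom_induction with
  | hC s hs _ =>
    obtain ⟨a, ha, b, hb, rfl⟩ := hs
    refine ⟨fun ω _ => decide (ω ∈ a), ?_, ((fun x : ℕ → Bool => x 0) ⁻¹' {true}) ×ˢ b,
      (measurable_pi_apply 0 (measurableSet_singleton _)).prod hb, ?_⟩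
    · refine measurable_pi_lambda _ fun _ => measurable_to_bool ?_
      have h : (fun ω => decide (ω ∈ a)) ⁻¹' {true} = a := by ext ω; simp
      exact h.symm ▸ ha
    · ext ⟨ω, x⟩
      simp
  | empty => exact ⟨fun _ _ => true, measurable_const, ∅, MeasurableSet.empty, rfl⟩
  | compl s _ ih =>
    obtain ⟨f, hf, t, ht, rfl⟩ := ih
    exact ⟨f, hf, tᶜ, ht.compl, rfl⟩
  | iUnion s _ ih =>
    choose f hf t ht hs using ih
    -- Pairing on `ℕ` packs countably many Cantor-valued maps into one.
    refine ⟨fun ω k => f k.unpair.1 ω k.unpair.2, measurable_pi_lambda _ fun k =>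
      (measurable_pi_apply _).comp (hf _),
      ⋃ n, Prod.map (fun (y : ℕ → Bool) j => y (Nat.pair n j)) id ⁻¹' t n,
      MeasurableSet.iUnion fun n => ?_, ?_⟩
    · exact ((measurable_pi_lambda _ fun j => measurable_pi_apply _).prodMap measurable_id) (ht n)
    · rw [preimage_iUnion]
      refine iUnion_congr fun n => ?_
      rw [hs n]
      ext ⟨ω, x⟩
      simp

/-- **Measurable projection theorem**: the projection of a measurable subset of `Ω × E`, with `E`
Polish, is measurable up to null sets for every finite measure. -/
theorem _root_.MeasurableSet.nullMeasurableSet_image_fst {Ω E : Type*} [MeasurableSpace Ω]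
    [TopologicalSpace E] [PolishSpace E] [MeasurableSpace E] [BorelSpace E] {s : Set (Ω × E)}
    (hs : MeasurableSet s) (μ : Measure Ω) [IsFiniteMeasure μ] :
    NullMeasurableSet (Prod.fst '' s) μ := by
  obtain ⟨f, hf, t, ht, rfl⟩ := hs.exists_preimage_prodMap_nat_bool
  have : TopologicalSpace.IsCompletelyMetrizableSpace (ℕ → Bool) := inferInstance
  have hA : AnalyticSet (Prod.fst '' t) := ht.analyticSet.image_of_continuous continuous_fst
  have h : Prod.fst '' (Prod.map f id ⁻¹' t) = f ⁻¹' (Prod.fst '' t) := by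
    ext ω
    constructor
    · rintro ⟨⟨ω', x⟩, hx, rfl⟩
      exact ⟨_, hx, rfl⟩
    · rintro ⟨⟨y, x⟩, hx, rfl⟩
      exact ⟨(ω, x), hx, rfl⟩
  rw [h]
  -- `Ω` has no topology, so universal measurability is applied to the law of `f` on the Cantor
  -- space.
  exact (hA.nullMeasurableSet (μ.map f)).preimage (hf.quasiMeasurePreserving μ)

end MeasureTheory

/-! ### Random sets and the conditional convex hull -/

section RandomSets

theorem supportFun_le_iff {E : Type*} [NormedAddCommGroup E] [NormedSpace ℝ E]
    {A : Set E} {u : StrongDual ℝ E} {c : EReal} :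
    supportFun A u ≤ c ↔ A ⊆ {x | ((u x : ℝ) : EReal) ≤ c} :=
  iSup₂_le_iff

theorem supportFun_mono {E : Type*} [NormedAddCommGroup E] [NormedSpace ℝ E]
    {A B : Set E} (h : A ⊆ B) (u : StrongDual ℝ E) :
    supportFun A u ≤ supportFun B u :=
  biSup_mono h

variable {Ω E : Type*} [MeasurableSpace E]

theorem IsRandomSet.mono {m m' : MeasurableSpace Ω} (h : m ≤ m') {X : Ω → Set E}
    (hX : IsRandomSet m X) : IsRandomSet m' X :=
  sup_le_sup (MeasurableSpace.comap_mono h) le_rfl _ hX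

/-- A countable intersection of random sets is a random set. -/
theorem IsRandomSet.iInter {ι : Type*} [Countable ι] {m : MeasurableSpace Ω} {X : ι → Ω → Set E}
    (hX : ∀ i, IsRandomSet m (X i)) : IsRandomSet m fun ω => ⋂ i, X i ω := by
  have h : setGraph (fun ω => ⋂ i, X i ω) = ⋂ i, setGraph (X i) := by
    ext p
    simp [setGraph]
  rw [IsRandomSet, h]
  exact MeasurableSet.iInter hX

/-- A random set hits a measurable set on an event that is measurable up to null sets. -/
theorem IsRandomSet.nullMeasurableSet_hitting [TopologicalSpace E] [PolishSpace E] [BorelSpace E]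
    {m : MeasurableSpace Ω} {X : Ω → Set E} (hX : IsRandomSet m X) (P : Measure[m] Ω)
    [IsFiniteMeasure P] {U : Set E} (hU : MeasurableSet U) :
    NullMeasurableSet {ω | (X ω ∩ U).Nonempty} P := by
  have h : {ω | (X ω ∩ U).Nonempty} = Prod.fst '' (setGraph X ∩ Prod.snd ⁻¹' U) := by
    ext ω
    constructor
    · rintro ⟨x, hx, hxU⟩
      exact ⟨(ω, x), ⟨hx, hxU⟩, rfl⟩
    · rintro ⟨⟨ω', x⟩, ⟨hx, hxU⟩, rfl⟩
      exact ⟨x, hx, hxU⟩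
  rw [h]
  exact (MeasurableSet.inter hX (measurable_snd hU)).nullMeasurableSet_image_fst P

variable [NormedAddCommGroup E] [NormedSpace ℝ E]

theorem IsRandomClosedConvexSet.iInter {ι : Type*} [Countable ι] {H mΩ : MeasurableSpace Ω}
    {P : Measure[mΩ] Ω} {Y : ι → Ω → Set E} (hY : ∀ i, IsRandomClosedConvexSet H P (Y i)) :
    IsRandomClosedConvexSet H P fun ω => ⋂ i, Y i ω where
  isRandomSet := IsRandomSet.iInter fun i => (hY i).isRandomSet
  isClosed := by
    filter_upwards [ae_all_iff.2 fun i => (hY i).isClosed] with ω hω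
    exact isClosed_iInter hω
  convex := by
    filter_upwards [ae_all_iff.2 fun i => (hY i).convex] with ω hω
    exact convex_iInter hω

theorem IsRandomClosedConvexSet.inter {H mΩ : MeasurableSpace Ω} {P : Measure[mΩ] Ω}
    {Y Z : Ω → Set E} (hY : IsRandomClosedConvexSet H P Y) (hZ : IsRandomClosedConvexSet H P Z) :
    IsRandomClosedConvexSet H P fun ω => Y ω ∩ Z ω where
  isRandomSet := MeasurableSet.inter hY.isRandomSet hZ.isRandomSet
  isClosed := hY.isClosed.mp (hZ.isClosed.mono fun _ h1 h2 => h2.inter h1)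
  convex := hY.convex.mp (hZ.convex.mono fun _ h1 h2 => h2.inter h1)

theorem IsRandomFunctional.measurable_uncurry [TopologicalSpace.SeparableSpace E] [BorelSpace E]
    {m : MeasurableSpace Ω} {ζ : Ω → StrongDual ℝ E} (hζ : IsRandomFunctional m ζ) :
    Measurable fun p : Ω × E => ζ p.1 p.2 := by
  have : SecondCountableTopology E := UniformSpace.secondCountable_of_separable E
  exact (measurable_uncurry_of_continuous_of_measurable (u := fun (x : E) ω => ζ ω x)
    (fun ω => (ζ ω).continuous) hζ).comp measurable_swap

/-- The random half-space `{x | ⟨ζ, x⟩ ≤ η}` is a random closed convex set. -/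
theorem IsRandomFunctional.isRandomClosedConvexSet_le [TopologicalSpace.SeparableSpace E]
    [BorelSpace E] {H mΩ : MeasurableSpace Ω} (P : Measure[mΩ] Ω) {ζ : Ω → StrongDual ℝ E}
    (hζ : IsRandomFunctional H ζ) {η : Ω → EReal} (hη : Measurable[H] η) :
    IsRandomClosedConvexSet H P fun ω => {x | ((ζ ω x : ℝ) : EReal) ≤ η ω} where
  isRandomSet := by
    let := H
    exact measurableSet_le hζ.measurable_uncurry.coe_real_ereal (hη.comp measurable_fst)
  isClosed := ae_of_all _ fun ω =>
    isClosed_le (continuous_coe_real_ereal.comp (ζ ω).continuous) continuous_const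
  convex := ae_of_all _ fun ω => by
    generalize η ω = c
    induction c with
    | bot => simpa using convex_empty
    | top => simpa using convex_univ
    | coe c => simpa using convex_halfSpace_le (ζ ω).isLinear c

variable [CompleteSpace E] [TopologicalSpace.SeparableSpace E] [BorelSpace E]

/-- The support function of a random set in a random direction is measurable up to null sets. -/
theorem IsRandomSet.nullMeasurable_supportFun {m : MeasurableSpace Ω} {X : Ω → Set E}
    (hX : IsRandomSet m X) (P : Measure[m] Ω) [IsFiniteMeasure P] {ζ : Ω → StrongDual ℝ E}
    (hζ : IsRandomFunctional m ζ) : NullMeasurable (fun ω => supportFun (X ω) (ζ ω)) P := by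
  have : SecondCountableTopology E := UniformSpace.secondCountable_of_separable E
  suffices hc : ∀ c, NullMeasurableSet ((fun ω => supportFun (X ω) (ζ ω)) ⁻¹' Ioi c) P from
    measurable_of_Ioi (δ := NullMeasurableSpace Ω P) hc
  intro c
  have h : (fun ω => supportFun (X ω) (ζ ω)) ⁻¹' Ioi c =
      Prod.fst '' (setGraph X ∩ {p : Ω × E | c < ((ζ p.1 p.2 : ℝ) : EReal)}) := by
    ext ω
    simp only [supportFun, mem_preimage, mem_Ioi, lt_iSup_iff]
    constructor
    · rintro ⟨x, hx, hc⟩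
      exact ⟨(ω, x), ⟨hx, hc⟩, rfl⟩
    · rintro ⟨⟨ω', x⟩, ⟨hx, hc⟩, rfl⟩
      exact ⟨x, hx, hc⟩
  rw [h]
  exact (MeasurableSet.inter hX (measurableSet_lt measurable_const
    hζ.measurable_uncurry.coe_real_ereal)).nullMeasurableSet_image_fst P

/-- The conditional convex hull of an arbitrary set-valued map exists. -/
theorem exists_isCondConvexHull {H mΩ : MeasurableSpace Ω} (hH : H ≤ mΩ) (P : Measure[mΩ] Ω)
    [IsFiniteMeasure P] (X : Ω → Set E) : ∃ M : Ω → Set E, IsCondConvexHull H P X M := by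
  have : SecondCountableTopology E := UniformSpace.secondCountable_of_separable E
  let C : Set (Ω → Set E) := {Y | IsRandomClosedConvexSet H P Y ∧ ∀ᵐ ω ∂P, X ω ⊆ Y ω}
  have hinter : ∀ {ι : Type _} [Countable ι] (Y : ι → Ω → Set E), (∀ i, Y i ∈ C) →
      (fun ω => ⋂ i, Y i ω) ∈ C := fun Y hY => by
    refine ⟨IsRandomClosedConvexSet.iInter fun i => (hY i).1, ?_⟩
    filter_upwards [ae_all_iff.2 fun i => (hY i).2] with ω hω
    exact subset_iInter hω
  have huniv : (fun _ => univ) ∈ C := by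
    refine ⟨⟨?_, ae_of_all _ fun _ => isClosed_univ, ae_of_all _ fun _ => convex_univ⟩,
      ae_of_all _ fun _ => subset_univ _⟩
    exact @MeasurableSet.univ _ (H.prod inferInstance)
  have hC : Nonempty C := ⟨⟨_, huniv⟩⟩
  let b := TopologicalSpace.countableBasis E
  have hb := TopologicalSpace.isBasis_countableBasis E
  have : Countable b := (TopologicalSpace.countable_countableBasis E).to_subtype
  let μ : (Ω → Set E) → Set E → ENNReal := fun Y U => P {ω | (Y ω ∩ U).Nonempty}
  have hmono : ∀ {Y Z : Ω → Set E} (U : Set E), (∀ ω, Y ω ⊆ Z ω) →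
      {ω | (Y ω ∩ U).Nonempty} ⊆ {ω | (Z ω ∩ U).Nonempty} := fun U h ω hω =>
    hω.mono (inter_subset_inter_left U (h ω))
  have hseq : ∀ U : b, ∃ Y : ℕ → C, ⨅ n, μ (Y n) U ≤ ⨅ Y : C, μ Y U := fun U => by
    obtain ⟨u, -, hu, hmem⟩ := exists_seq_tendsto_sInf (range_nonempty fun Y : C => μ Y U)
      (OrderBot.bddBelow _)
    choose Y hY using hmem
    refine ⟨Y, ge_of_tendsto' hu fun n => ?_⟩
    rw [← hY n]
    exact iInf_le (fun n => μ (Y n) U) n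
  choose Y hY using hseq
  let M : Ω → Set E := fun ω => ⋂ p : b × ℕ, (Y p.1 p.2).1 ω
  have hM : M ∈ C := hinter (fun p : b × ℕ => (Y p.1 p.2).1) fun p => (Y p.1 p.2).2
  refine ⟨M, hM.1, hM.2, fun Y' hY' hXY' => ?_⟩
  let Z : Ω → Set E := fun ω => M ω ∩ Y' ω
  have hZ : Z ∈ C :=
    ⟨hM.1.inter hY', hM.2.mp (hXY'.mono fun ω h1 h2 => subset_inter h2 h1)⟩
  have hZM : ∀ ω, Z ω ⊆ M ω := fun ω => inter_subset_left
  have hZY : ∀ ω, Z ω ⊆ Y' ω := fun ω => inter_subset_right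
  -- `Z` also belongs to `C`, so it cannot hit `U` with smaller probability than `M`.
  have hhit : ∀ U : b, {ω | (Z ω ∩ U).Nonempty} =ᵐ[P] {ω | (M ω ∩ U).Nonempty} := fun U => by
    refine ae_eq_of_subset_of_measure_ge (hmono U hZM) ?_
      ((hZ.1.isRandomSet.mono hH).nullMeasurableSet_hitting P
        (hb.isOpen U.2).measurableSet) (measure_ne_top _ _)
    calc μ M U ≤ ⨅ n, μ (Y U n) U :=
          le_iInf fun n => measure_mono (hmono U fun ω => iInter_subset _ (U, n))
      _ ≤ ⨅ Y : C, μ Y U := hY U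
      _ ≤ μ Z U := iInf_le (fun Y : C => μ Y U) ⟨Z, hZ⟩
  filter_upwards [hY'.isClosed, ae_all_iff.2 hhit] with ω hcl hω x hx
  by_contra hxY
  obtain ⟨U, hU, hxU, hsub⟩ := hb.exists_subset_of_mem_open hxY hcl.isOpen_compl
  obtain ⟨z, hz, hzU⟩ := (hω ⟨U, hU⟩).mpr ⟨x, hx, hxU⟩
  exact hsub hzU (hZY ω hz)

end RandomSets

theorem theorem5p2 {Ω E : Type*}
    [NormedAddCommGroup E] [NormedSpace ℝ E] [CompleteSpace E]
    [TopologicalSpace.SeparableSpace E] [MeasurableSpace E] [BorelSpace E]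
    (H : MeasurableSpace Ω) {mΩ : MeasurableSpace Ω} (hH : H ≤ mΩ)
    (P : Measure[mΩ] Ω) [IsProbabilityMeasure P] [P.IsComplete]
    (X : Ω → Set E) (hX : IsRandomSet mΩ X) :
    (∃ M : Ω → Set E, IsCondConvexHull H P X M) ∧
    ∀ M : Ω → Set E, IsCondConvexHull H P X M →
      ∀ ζ : Ω → StrongDual ℝ E, IsRandomFunctional H ζ →
        Measurable[mΩ] (fun ω => supportFun (X ω) (ζ ω)) ∧
        ∃ η : Ω → EReal,
          IsCondEssSup H P {fun ω => supportFun (X ω) (ζ ω)} η ∧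
          ∀ᵐ ω ∂P, supportFun (M ω) (ζ ω) = η ω := by
  refine ⟨exists_isCondConvexHull hH P X, fun M hM ζ hζ => ⟨?_, ?_⟩⟩
  · exact (hX.nullMeasurable_supportFun P fun x => (hζ x).mono hH le_rfl).measurable_of_complete
  -- `H` need not be complete: projecting under the trimmed measure makes the exceptional null sets
  -- `H`-measurable, so `η` can be chosen `H`-measurable.
  · have : IsFiniteMeasure (P.trim hH) := isFiniteMeasure_trim hH
    have hae : @AEMeasurable _ _ _ H (fun ω => supportFun (M ω) (ζ ω)) (P.trim hH) :=
      (hM.isRandomClosedConvexSet.isRandomSet.nullMeasurable_supportFun (P.trim hH)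
        hζ).aemeasurable
    obtain ⟨η, hη, heq⟩ := hae
    have heq' : ∀ᵐ ω ∂P, supportFun (M ω) (ζ ω) = η ω := ae_of_ae_trim hH heq
    refine ⟨η, ⟨hη, ?_, fun η' hη' hle => ?_⟩, heq'⟩
    · rintro _ rfl
      filter_upwards [heq', hM.subset] with ω h1 h2
      exact (supportFun_mono h2 _).trans_eq h1
    · filter_upwards [heq', hM.minimal _ (hζ.isRandomClosedConvexSet_le P hη')
        ((hle _ rfl).mono fun ω h => supportFun_le_iff.1 h)] with ω h1 h2
      exact h1 ▸ supportFun_le_iff.2 h2
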